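/- Let $k$ be a field of characteristic $0$ and let $K$ be a function field over $k$, that is, a finite extension of a rational function field $k(T)$ with $T$ transcendental over $k$. A prime $\mathfrak p$ of $K$ is a discrete valuation ring of $K$ (with field of fractions $K$) containing $k$, and $\mathrm{ord}_{\mathfrak p}$ denotes its normalized valuation, with $\mathrm{ord}_{\mathfrak p}0=\infty$. Let $\mathcal S$ be a nonempty finite set of primes of $K$, and let $$O_{K,\mathcal S}=\{x\in K \mid \mathrm{ord}_{\mathfrak p}\,x\ge 0 \text{ for every prime } \mathfrak p\notin\mathcal S \text{ of } K\}.$$ Then $\mathbb Z$ has a single-fold Diophantine definition over $O_{K,\mathcal S}$: there are an integer $m>0$ and a polynomial $f(T,X_1,\dots,X_m)$ with coefficients in $O_{K,\mathcal S}$ such that, for every $t\in O_{K,\mathcal S}$, we have $t\in\mathbb Z$ if and only if there are $x_1,\dots,x_m\in O_{K,\mathcal S}$ with $f(t,x_1,\dots,x_m)=0$, and for every $t\in\mathbb Z$ the tuple $(x_1,\dots,x_m)$ is unique. -/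

import Mathlib

open IsDedekindDomain
open scoped RatFunc WithZero

/-- A prime of a function field `K` over `k`: a discrete valuation ring of `K` (a discrete
valuation subring, so with field of fractions `K`) which contains `k`. -/
structure FunctionFieldPrime (k K : Type*) [Field k] [Field K] [Algebra k K] where
  /-- the valuation ring of the prime -/
  ring : ValuationSubring K
  algebraMap_mem : ∀ c : k, algebraMap k K c ∈ ring
  isDVR : IsDiscreteValuationRing ring

namespace FunctionFieldPrime

variable {k K : Type*} [Field k] [Field K] [Algebra k K]

instance (p : FunctionFieldPrime k K) : IsDiscreteValuationRing p.ring := p.isDVR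

/-- The normalized discrete valuation of `K` at the prime `p`, written multiplicatively: its value
at `x ≠ 0` is `exp (-n)` with `n = ord_p x`, where `n` is the largest integer with
`x ∈ 𝔪 ^ n` for `x` in the valuation ring with maximal ideal `𝔪`, and orders of quotients are
differences; its value at `0` is `0`. So `ord_p x ≥ 0` reads `p.valuation x ≤ 1`. -/
noncomputable def valuation (p : FunctionFieldPrime k K) : Valuation K ℤᵐ⁰ :=
  (IsDiscreteValuationRing.maximalIdeal p.ring).valuation K

theorem valuation_le_one_iff (p : FunctionFieldPrime k K) (x : K) :
    p.valuation x ≤ 1 ↔ x ∈ p.ring := by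
  constructor
  · intro h
    obtain ⟨y, rfl⟩ := IsDiscreteValuationRing.exists_lift_of_le_one (A := p.ring) h
    exact y.2
  · intro h
    exact (IsDiscreteValuationRing.maximalIdeal p.ring).valuation_le_one (K := K) ⟨x, h⟩

end FunctionFieldPrime

/-- The ring `O_{K,S}` of `S`-integers of the function field `K` over `k`: the elements of `K`
whose order is nonnegative at every prime of `K` outside `S`. -/
noncomputable def sIntegers {k K : Type*} [Field k] [Field K] [Algebra k K]
    (S : Set (FunctionFieldPrime k K)) : Subring K where
  carrier := {x : K | ∀ p : FunctionFieldPrime k K, p ∉ S → p.valuation x ≤ 1}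
  mul_mem' := fun hx hy p hp => p.valuation.integer.mul_mem (hx p hp) (hy p hp)
  one_mem' := fun p _ => p.valuation.integer.one_mem
  add_mem' := fun hx hy p hp => p.valuation.integer.add_mem (hx p hp) (hy p hp)
  zero_mem' := fun p _ => p.valuation.integer.zero_mem
  neg_mem' := fun hx p hp => p.valuation.integer.neg_mem (hx p hp)

/-- `f(T₁, …, Tₙ, X₁, …, Xₘ)` is a Diophantine definition over `R` of the subset `A` of `Rⁿ`. -/
def IsDiophantineDefinition {R : Type*} [CommRing R] {n m : ℕ} (A : Set (Fin n → R))
    (f : MvPolynomial (Fin n ⊕ Fin m) R) : Prop :=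
  ∀ t : Fin n → R, t ∈ A ↔ ∃ x : Fin m → R, MvPolynomial.eval (Sum.elim t x) f = 0

/-- A Diophantine definition `f` of `A` is single-fold if, for every `t ∈ A`, the tuple `x` with
`f(t, x) = 0` is unique. -/
def IsSingleFoldDefinition {R : Type*} [CommRing R] {n m : ℕ} (A : Set (Fin n → R))
    (f : MvPolynomial (Fin n ⊕ Fin m) R) : Prop :=
  IsDiophantineDefinition A f ∧
    ∀ t ∈ A, ∃! x : Fin m → R, MvPolynomial.eval (Sum.elim t x) f = 0

/-- `A` has a single-fold Diophantine definition over `R`. -/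
def HasSingleFoldDefinition {R : Type*} [CommRing R] {n : ℕ} (A : Set (Fin n → R)) : Prop :=
  ∃ m : ℕ, 0 < m ∧ ∃ f : MvPolynomial (Fin n ⊕ Fin m) R, IsSingleFoldDefinition A f

/-- The rational integers as a subset of `R¹`. -/
def rationalIntegers (R : Type*) [CommRing R] : Set (Fin 1 → R) :=
  {t | ∃ z : ℤ, t 0 = (z : R)}

/-! Fix `p ∈ S` and `r ∉ S`, and take a function `e` whose only pole is `p`, with simple zeros at
`r` and at the primes of `S` other than `p`. Put `a = 1 + e` and consider `X² - (a² - 1)Y² = 1` over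
the `S`-integers. At the primes of `S` other than `p`, `a² - 1 = e(e + 2)` has order one, so the
orders of `X²` and `(a² - 1)Y²` differ in parity, their poles cannot cancel, and solutions have no
pole away from `p` (`Valuation.le_one_of_pell`). A nonzero function with no pole outside `p` cannot
vanish at `p`, so descent on the pole order of `Y` leaves only `(±Tₙ(a), Uₙ₋₁(a))`
(`Valuation.pell_eq_chebyshev`). As `a ≡ 1` modulo `e`, `Uₙ₋₁(a) ≡ Uₙ₋₁(1) = n`; hence asking for `Y
= t + ez` says that `t` is congruent to an integer modulo `e`.

To turn the congruence into an equality, each `t + i` with `0 ≤ i ≤ |S|` is required to be zero or a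
unit. For transcendental `t` these translates have zeros at distinct primes, one of them outside
`S`, so `t` must be algebraic over `k`; then `t - n` is a constant vanishing at `r`, hence zero.

Witnesses are unique: writing `X = 1 + ew` fixes the sign because `e` does not divide 2, `t`
determines `n` in characteristic 0, and generalized inverses are unique. The equations merge into
one through `u² - ev²`, anisotropic because `e` has odd order at `r`.

The function `e` comes from the Chinese remainder theorem in the integral closure of `k[T]`, where
`T` has `p` as its only pole; `T` itself comes from a dimension count in place of Riemann–Roch
(`exists_ne_zero_mem_pow_of_basis`). -/

theorem isPrincipalIdealRing_adjoin_of_transcendental {k K : Type*} [Field k] [Field K]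
    [Algebra k K] {T : K} (hT : Transcendental k T) :
    IsPrincipalIdealRing (Algebra.adjoin k {T}) :=
  IsPrincipalIdealRing.of_surjective (Polynomial.algEquivOfTranscendental k T hT)
    (Polynomial.algEquivOfTranscendental k T hT).surjective

/-! ### Integral closures of `k[T]`, centres of primes, existence of poles. -/

section FunctionField

variable {k K : Type*} [Field k] [Field K] [Algebra k K]

section

variable [Algebra k⟮X⟯ K] [IsScalarTower k k⟮X⟯ K] [FunctionField k K]

/-- A function field is finite over the subfield generated by any transcendental element. -/
theorem finiteDimensional_adjoin_of_transcendental {T : K} (hT : Transcendental k T) :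
    FiniteDimensional (IntermediateField.adjoin k {T}) K := by
  -- An algebraic extension essentially of finite type is finite; algebraicity holds because `K` has
  -- transcendence degree one.
  have h1 : Algebra.EssFiniteType k k⟮X⟯ :=
    have : Algebra.EssFiniteType (Polynomial k) k⟮X⟯ :=
      .of_isLocalization _ (nonZeroDivisors (Polynomial k))
    .comp k (Polynomial k) k⟮X⟯
  have h2 : Algebra.EssFiniteType k K := .comp k k⟮X⟯ K
  have h3 : Algebra.EssFiniteType (IntermediateField.adjoin k {T}) K :=
    .of_comp k _ _
  have h4 : Algebra.trdeg k k⟮X⟯ = 1 := by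
    have h := trdeg_add_eq k (Polynomial k) (A := k⟮X⟯)
    have : Algebra.IsAlgebraic (Polynomial k) k⟮X⟯ :=
      IsLocalization.isAlgebraic _ (nonZeroDivisors (Polynomial k))
    rwa [Polynomial.trdeg_of_isDomain, trdeg_eq_zero (R := Polynomial k), add_zero,
      eq_comm] at h
  have h5 : Algebra.trdeg k K = 1 := by
    have h := lift_trdeg_add_eq k k⟮X⟯ K
    rw [h4, trdeg_eq_zero (R := k⟮X⟯)] at h
    simpa [eq_comm] using h
  have h6 : Algebra.IsAlgebraic (IntermediateField.adjoin k {T}) K := by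
    have hi : AlgebraicIndependent k (fun _ : Unit => T) :=
      algebraicIndependent_unique_type_iff.2 hT
    have := (hi.isTranscendenceBasis_of_lift_trdeg_le_of_finite (by simp [h5])).isAlgebraic_field
    rwa [Set.range_const] at this
  exact Algebra.finite_of_essFiniteType_of_isAlgebraic

open scoped IntermediateField.algebraAdjoinAdjoin in
theorem isFractionRing_integralClosure_adjoin {T : K} (hT : Transcendental k T) :
    IsFractionRing (integralClosure (Algebra.adjoin k {T}) K) K :=
  have := finiteDimensional_adjoin_of_transcendental hT
  IsIntegralClosure.isFractionRing_of_finite_extension (Algebra.adjoin k {T})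
    (IntermediateField.adjoin k {T}) K _

variable [CharZero k]

open scoped IntermediateField.algebraAdjoinAdjoin in
theorem isDedekindDomain_integralClosure_adjoin {T : K} (hT : Transcendental k T) :
    IsDedekindDomain (integralClosure (Algebra.adjoin k {T}) K) :=
  have := isPrincipalIdealRing_adjoin_of_transcendental hT
  have := finiteDimensional_adjoin_of_transcendental hT
  have : CharZero K := charZero_of_injective_algebraMap (algebraMap k K).injective
  IsIntegralClosure.isDedekindDomain (Algebra.adjoin k {T}) (IntermediateField.adjoin k {T}) K _

open scoped IntermediateField.algebraAdjoinAdjoin in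
theorem free_integralClosure_adjoin {T : K} (hT : Transcendental k T) :
    Module.Free (Algebra.adjoin k {T}) (integralClosure (Algebra.adjoin k {T}) K) :=
  have := isPrincipalIdealRing_adjoin_of_transcendental hT
  have := finiteDimensional_adjoin_of_transcendental hT
  have : CharZero K := charZero_of_injective_algebraMap (algebraMap k K).injective
  IsIntegralClosure.module_free (Algebra.adjoin k {T}) (IntermediateField.adjoin k {T}) K _

open scoped IntermediateField.algebraAdjoinAdjoin in
theorem finite_integralClosure_adjoin {T : K} (hT : Transcendental k T) :
    Module.Finite (Algebra.adjoin k {T}) (integralClosure (Algebra.adjoin k {T}) K) :=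
  have := isPrincipalIdealRing_adjoin_of_transcendental hT
  have := finiteDimensional_adjoin_of_transcendental hT
  have : CharZero K := charZero_of_injective_algebraMap (algebraMap k K).injective
  IsIntegralClosure.finite (Algebra.adjoin k {T}) (IntermediateField.adjoin k {T}) K _

end

namespace FunctionFieldPrime

theorem ext_ring {p q : FunctionFieldPrime k K} (h : p.ring = q.ring) : p = q := by
  cases p; cases q; cases h; rfl

theorem mem_ring_of_isAlgebraic (p : FunctionFieldPrime k K) {x : K} (hx : IsAlgebraic k x) :
    x ∈ p.ring := by
  obtain ⟨y, hy⟩ := IsIntegrallyClosed.isIntegral_iff (R := p.ring) (K := K) |>.1 <|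
    (hx.isIntegral.map_of_comp_eq (algebraMap k K |>.codRestrict p.ring.toSubring p.algebraMap_mem)
      (RingHom.id K) rfl)
  exact (show (y : K) = x from hy) ▸ y.2

theorem algebraMap_integralClosure_mem (p : FunctionFieldPrime k K) {T : K} (hT : T ∈ p.ring)
    (x : integralClosure (Algebra.adjoin k {T}) K) : algebraMap _ K x ∈ p.ring := by
  have h : ∀ y : Algebra.adjoin k {T}, (y : K) ∈ p.ring := by
    rintro ⟨y, hy⟩
    induction hy using Algebra.adjoin_induction with
    | mem x hx => exact (Set.mem_singleton_iff.1 hx) ▸ hT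
    | algebraMap r => exact p.algebraMap_mem r
    | add x y _ _ hx hy => exact p.ring.add_mem _ _ hx hy
    | mul x y _ _ hx hy => exact p.ring.mul_mem _ _ hx hy
  obtain ⟨y, hy⟩ := IsIntegrallyClosed.isIntegral_iff (R := p.ring) (K := K) |>.1 <|
    (IsIntegral.map_of_comp_eq
      ((algebraMap (Algebra.adjoin k {T}) K).codRestrict p.ring.toSubring h)
      (RingHom.id K) rfl x.2)
  exact hy ▸ y.2

theorem ring_ne_top (p : FunctionFieldPrime k K) : p.ring ≠ ⊤ := by
  intro h
  apply IsDiscreteValuationRing.not_isField p.ring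
  refine ⟨exists_pair_ne _, mul_comm, fun {a} ha =>
    ⟨⟨(a : K)⁻¹, h.ge (ValuationSubring.mem_top _)⟩, ?_⟩⟩
  exact Subtype.ext (mul_inv_cancel₀ (by simpa using ha))

section Center

variable {A : Type*} [CommRing A] [IsDedekindDomain A] [Algebra A K] [IsFractionRing A K]

/-- A nontrivial valuation ring containing a Dedekind domain with the same field of fractions is
the valuation ring of a maximal ideal. -/
theorem exists_ring_eq_valuationSubring (p : FunctionFieldPrime k K)
    (hA : ∀ a : A, algebraMap A K a ∈ p.ring) :
    ∃ Q : HeightOneSpectrum A, p.ring = (Q.valuation K).valuationSubring := by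
  let f : A →+* p.ring := (algebraMap A K).codRestrict p.ring.toSubring hA
  let Q : HeightOneSpectrum A :=
    { asIdeal := (IsLocalRing.maximalIdeal p.ring).comap f
      isPrime := inferInstance
      ne_bot := by
        intro h
        apply p.ring_ne_top
        refine eq_top_iff.2 fun x _ => ?_
        obtain ⟨a, b, hb, rfl⟩ := IsFractionRing.div_surjective A x
        have hb0 : b ∉ (IsLocalRing.maximalIdeal p.ring).comap f := by
          rw [h]; exact nonZeroDivisors.ne_zero hb
        have hu : IsUnit (f b) := by simpa using hb0
        obtain ⟨u, hu⟩ := hu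
        have : (algebraMap A K b)⁻¹ = ((u⁻¹ : p.ringˣ) : p.ring) := by
          have h1 : (u : p.ring) * (u⁻¹ : p.ringˣ) = 1 := by simp
          have h2 := congrArg (Subtype.val) h1
          rw [hu] at h2
          exact inv_eq_of_mul_eq_one_right h2
        rw [div_eq_mul_inv, this]
        exact p.ring.mul_mem _ _ (hA a) (SetLike.coe_mem _) }
  refine ⟨Q, ?_⟩
  rw [← HeightOneSpectrum.valuationSubringAtPrime_eq_valuationSubring]
  symm
  -- The localization at the centre `Q` is a discrete valuation ring, so the only larger subrings of
  -- `K` are itself and `K`.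
  refine ValuationSubring.eq_of_le_of_ne_top _ ?_ p.ring_ne_top
  rw [HeightOneSpectrum.valuationSubringAtPrime_eq_valuationSubring]
  intro x hx
  obtain ⟨n, d, hnd⟩ := Q.exists_primeCompl_mul_eq_of_integer x hx
  have hu : IsUnit (f d) := by
    have := d.2
    simpa [Q, Ideal.primeCompl] using this
  obtain ⟨u, hu⟩ := hu
  have h1 : (u : p.ring) * (u⁻¹ : p.ringˣ) = 1 := by simp
  have h2 := congrArg (Subtype.val) h1
  rw [hu] at h2
  have : x = algebraMap A K n * ((u⁻¹ : p.ringˣ) : p.ring) := by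
    rw [← hnd, mul_assoc]
    exact ((congrArg (x * ·) h2).trans (mul_one x)).symm
  rw [this]
  exact p.ring.mul_mem _ _ (hA n) (SetLike.coe_mem _)

end Center

end FunctionFieldPrime

/-- The prime of a function field given by a maximal ideal of a Dedekind domain. -/
noncomputable def FunctionFieldPrime.ofHeightOneSpectrum {A : Type*} [CommRing A] [IsDedekindDomain A]
    [Algebra A K] [IsFractionRing A K] (Q : HeightOneSpectrum A)
    (h : ∀ c : k, Q.valuation K (algebraMap k K c) ≤ 1) : FunctionFieldPrime k K where
  ring := (Q.valuation K).valuationSubring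
  algebraMap_mem := h
  isDVR := inferInstanceAs (IsDiscreteValuationRing (Q.valuation K).integer)

/-- Every transcendental element of a function field has a pole. -/
theorem exists_prime_notMem_of_transcendental [CharZero k] [Algebra k⟮X⟯ K]
    [IsScalarTower k k⟮X⟯ K] [FunctionField k K] {x : K} (hx : Transcendental k x) :
    ∃ p : FunctionFieldPrime k K, x ∉ p.ring := by
  -- A pole of `x` is a zero of `x⁻¹`: the latter is a nonunit of `k[x⁻¹]`, remains one in the
  -- integral closure, and so lies in a maximal ideal.
  have hT : Transcendental k x⁻¹ := by
    rwa [Transcendental, IsAlgebraic.inv_iff]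
  have := isPrincipalIdealRing_adjoin_of_transcendental hT
  have := isDedekindDomain_integralClosure_adjoin hT
  have := isFractionRing_integralClosure_adjoin hT
  set R := Algebra.adjoin k {x⁻¹}
  let t : R := ⟨x⁻¹, Algebra.subset_adjoin rfl⟩
  let A := integralClosure R K
  have hx0 : x ≠ 0 := by rintro rfl; exact hx isAlgebraic_zero
  have hloc : IsLocalHom (algebraMap R A) := by
    refine (algebraMap_isIntegral_iff.2 inferInstance).isLocalHom fun a b h => ?_
    exact Subtype.ext (congrArg (fun y : A => (y : K)) h)
  have hnu : ¬ IsUnit (algebraMap R A t) := by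
    intro h
    have h1 : IsUnit t := isUnit_of_map_unit (algebraMap R A) t h
    have h2 := h1.map (Polynomial.algEquivOfTranscendental k _ hT).symm
    have h3 : (Polynomial.algEquivOfTranscendental k _ hT).symm t = Polynomial.X := by
      rw [AlgEquiv.symm_apply_eq]
      ext
      simp [t]
    rw [h3] at h2
    exact Polynomial.not_isUnit_X h2
  obtain ⟨m, hm, hmem⟩ := exists_max_ideal_of_mem_nonunits hnu
  let Q : HeightOneSpectrum A :=
    { asIdeal := m
      isPrime := hm.isPrime
      ne_bot := by
        rintro rfl
        have h1 : ((algebraMap R A t : A) : K) = 0 := congrArg Subtype.val (Ideal.mem_bot.1 hmem)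
        exact inv_ne_zero hx0 h1 }
  refine ⟨.ofHeightOneSpectrum Q fun c => ?_, ?_⟩
  · exact Q.valuation_le_one (K := K) (algebraMap R A (algebraMap k R c))
  · have h : Q.valuation K x⁻¹ < 1 := (Q.valuation_lt_one_iff_mem (K := K) (algebraMap R A t)).2 hmem
    intro h'
    have h' : Q.valuation K x ≤ 1 := h'
    rw [map_inv₀, inv_lt_one₀ (by simpa [zero_lt_iff] using hx0)] at h
    exact h'.not_gt h

end FunctionField

/-! ### A dimension count in place of Riemann–Roch. -/

open Polynomial in
/-- Sections of a power of an ideal properly containing a uniformizing element, with bounded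
degrees of the coordinates with respect to a basis over a polynomial ring. -/
theorem exists_ne_zero_mem_pow_of_basis {k R A ι : Type*} [Field k] [CommRing R] [Algebra k R]
    [CommRing A] [IsDedekindDomain A] [Algebra R A] [Algebra k A] [IsScalarTower k R A]
    [Fintype ι] (e : k[X] ≃ₐ[k] R) (b : Module.Basis ι R A) {I Q : Ideal A}
    (hIQ : I * Q = Ideal.span {algebraMap R A (e X)}) (hQ : Q ≠ ⊤)
    (hx : algebraMap R A (e X) ≠ 0) (c : ℕ) :
    ∃ d : ℕ, ∃ r : ι → ℕ → k,
      ∑ i, ∑ m ∈ Finset.range d, r i m • (algebraMap R A (e X) ^ m * b i) ∈ I ^ (d + c) ∧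
      ∑ i, ∑ m ∈ Finset.range d, r i m • (algebraMap R A (e X) ^ m * b i) ≠ 0 := by
  classical
  set x : A := algebraMap R A (e X) with hxdef
  -- Killing the coefficients in degrees `d, …, d + c - 1` costs `|ι| * c` linear conditions, fewer
  -- than the `n = d + c` available parameters.
  let d := Fintype.card ι * c + 1
  let n := d + c
  set Y : Ideal A := Ideal.span {x} with hY
  have hY0 : Y ≠ 0 := by simpa [hY] using hx
  have hI0 : I ≠ 0 := by rintro rfl; exact hY0 (by rw [← hIQ, zero_mul])
  have hYI : Y ≤ I := hIQ ▸ Ideal.mul_le_left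
  have hne : I ≠ Y := by
    intro h
    have h1 : I * Q = I * 1 := by rw [hIQ, mul_one, ← h]
    exact hQ (by simpa using mul_left_cancel₀ hI0 h1)
  -- A chain from `(xⁿ)` to `Iⁿ` with `n` strict steps; one new element per step gives `n` vectors
  -- independent over `k` modulo `(xⁿ)`.
  let J : ℕ → Ideal A := fun j => I ^ j * Y ^ (n - j)
  have hJmono : ∀ i j, i ≤ j → j ≤ n → J i ≤ J j := by
    intro i j hij hj
    have h1 : n - i = (j - i) + (n - j) := by omega
    have h2 : I ^ j = I ^ i * I ^ (j - i) := by rw [← pow_add]; congr 1; omega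
    simp only [J]
    rw [h1, h2, pow_add, mul_assoc]
    exact Ideal.mul_mono_right (Ideal.mul_mono_left (Ideal.pow_right_mono hYI _))
  have hz : ∀ j : Fin n, ∃ z, z ∈ J (j + 1) ∧ z ∉ J j := by
    intro j
    apply SetLike.exists_of_lt
    refine lt_of_le_of_ne (hJmono _ _ (Nat.le_succ _) j.2) fun h => hne ?_
    have h1 : n - j = (n - (j + 1)) + 1 := by omega
    simp only [J] at h
    rw [h1] at h
    refine (mul_left_cancel₀ (mul_ne_zero (pow_ne_zero j hI0) (pow_ne_zero (n - (j + 1)) hY0))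
      (?_ : _ * Y = _ * I)).symm
    rw [mul_assoc, ← pow_succ, h]
    ring
  choose z hz1 hz2 using hz
  let p : A →ₗ[k] (ι → k[X]) :=
    (LinearMap.pi fun i => (e.symm.toLinearMap : R →ₗ[k] k[X]) ∘ₗ
      ((LinearMap.proj i : (ι → R) →ₗ[R] R) ∘ₗ b.equivFun.toLinearMap).restrictScalars k)
  have hp : ∀ a : A, a = ∑ i, e (p a i) • b i := by
    intro a
    conv_lhs => rw [← b.sum_equivFun a]
    simp [p]
  let Z : (Fin n → k) →ₗ[k] A := Fintype.linearCombination k z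
  let Ψ : (Fin n → k) →ₗ[k] (ι × Fin c → k) :=
    LinearMap.pi fun ij => (lcoeff k (d + ij.2)) ∘ₗ (LinearMap.proj ij.1) ∘ₗ p ∘ₗ Z
  obtain ⟨a, ha, ha0⟩ : ∃ a, Ψ a = 0 ∧ a ≠ 0 := by
    have : LinearMap.ker Ψ ≠ ⊥ := by
      apply LinearMap.ker_ne_bot_of_finrank_lt
      simp [n, d]
      omega
    exact Submodule.exists_mem_ne_zero_of_ne_bot this
  have hZn : Z a ∈ J n := by
    simp only [Z, Fintype.linearCombination_apply]
    refine Submodule.sum_mem _ fun j _ => ?_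
    exact Submodule.smul_of_tower_mem _ _ (hJmono _ _ j.2 le_rfl (hz1 j))
  have hZ0 : Z a ∉ J 0 := by
    intro h
    obtain ⟨j0, hj0⟩ := Function.ne_iff.1 ha0
    obtain ⟨j, hj, hmax⟩ := (Finset.univ.filter (fun j => a j ≠ 0)).exists_max_image id
      ⟨j0, by simpa using hj0⟩
    have haj : a j ≠ 0 := by simpa using hj
    apply hz2 j
    have h1 : a j • z j = Z a - ∑ l ∈ Finset.univ.erase j, a l • z l := by
      simp only [Z, Fintype.linearCombination_apply]
      rw [← Finset.add_sum_erase _ _ (Finset.mem_univ j)]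
      ring
    have h2 : a j • z j ∈ J j := by
      rw [h1]
      refine Submodule.sub_mem _ (hJmono _ _ (Nat.zero_le _) j.2.le h) ?_
      refine Submodule.sum_mem _ fun l hl => ?_
      by_cases hal : a l = 0
      · simp [hal]
      · have hlj : l ≤ j := hmax l (by simpa using hal)
        have hlj' : l < j := lt_of_le_of_ne hlj (Finset.ne_of_mem_erase hl)
        exact Submodule.smul_of_tower_mem _ _ (hJmono _ _ hlj' j.2.le (hz1 l))
    simpa [smul_smul, haj] using Submodule.smul_of_tower_mem (J j) (a j)⁻¹ h2
  refine ⟨d, fun i m => (p (Z a) i).coeff m, ?_⟩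
  -- Truncation changes `Z a` by a multiple of `xⁿ`, so the result stays in `Iⁿ` and outside `(xⁿ)`;
  -- in particular it is nonzero.
  set g' := ∑ i, ∑ m ∈ Finset.range d, (p (Z a) i).coeff m • (x ^ m * b i) with hg'
  have hsub : Z a - g' ∈ J 0 := by
    have h1 : ∀ i, X ^ n ∣ p (Z a) i - ∑ m ∈ Finset.range d, monomial m ((p (Z a) i).coeff m) := by
      intro i
      rw [X_pow_dvd_iff]
      intro m hm
      rw [coeff_sub, finsetSum_coeff]
      simp only [coeff_monomial, Finset.sum_ite_eq', Finset.mem_range]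
      split_ifs with h
      · exact sub_self _
      · rw [sub_zero]
        have := congrFun ha (i, ⟨m - d, by omega⟩)
        simpa [Ψ, show d + (m - d) = m by omega] using this
    choose q hq using h1
    have h2 : Z a - g' = x ^ n * ∑ i, e (q i) • b i := by
      conv_lhs => rw [hp (Z a)]
      rw [hg', ← Finset.sum_sub_distrib, Finset.mul_sum]
      refine Finset.sum_congr rfl fun i _ => ?_
      have h3 : e (p (Z a) i) = e X ^ n * e (q i) +
          ∑ m ∈ Finset.range d, (p (Z a) i).coeff m • e X ^ m := by
        rw [← map_pow, ← map_mul, ← hq i, map_sub]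
        simp only [map_sum, ← C_mul_X_pow_eq_monomial, ← smul_eq_C_mul, map_smul, map_pow,
          sub_add_cancel]
      rw [h3]
      simp only [Algebra.smul_def, hxdef, map_add, map_mul, map_pow, map_sum, add_mul,
        Finset.sum_mul, ← IsScalarTower.algebraMap_apply]
      simp only [mul_assoc, add_sub_cancel_right]
    rw [h2]
    simp only [J, pow_zero, one_mul, Nat.sub_zero, hY, Ideal.span_singleton_pow]
    exact Ideal.mul_mem_right _ _ (Ideal.mem_span_singleton_self _)
  constructor
  · have h := Submodule.sub_mem _ hZn (hJmono _ _ (Nat.zero_le _) le_rfl hsub)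
    simpa [J] using h
  · intro h
    rw [h, sub_zero] at hsub
    exact hZ0 hsub

/-! ### Functions with a single pole. -/

section FunctionField

variable {k K : Type*} [Field k] [Field K] [Algebra k K]

theorem transcendental_of_inv_notMem {p : FunctionFieldPrime k K} {x : K} (hx : x⁻¹ ∉ p.ring) :
    Transcendental k x :=
  fun h => hx (p.mem_ring_of_isAlgebraic h.inv)

theorem FunctionFieldPrime.valuation_lt_one_iff (p : FunctionFieldPrime k K) {x : K} (hx : x ≠ 0) :
    p.valuation x < 1 ↔ x⁻¹ ∉ p.ring := by
  rw [← p.valuation_le_one_iff, map_inv₀, not_le, one_lt_inv₀]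
  simpa [zero_lt_iff] using hx

theorem FunctionFieldPrime.valuation_algebraMap (p : FunctionFieldPrime k K) {c : k}
    (hc : c ≠ 0) : p.valuation (algebraMap k K c) = 1 := by
  refine le_antisymm ((p.valuation_le_one_iff _).2 (p.algebraMap_mem c)) ?_
  rw [← inv_le_one₀ (by simpa [zero_lt_iff] using hc), ← map_inv₀, ← map_inv₀,
    p.valuation_le_one_iff]
  exact p.algebraMap_mem _

open Polynomial in
theorem FunctionFieldPrime.aeval_mem_ring (p : FunctionFieldPrime k K) {y : K} (hy : y ∈ p.ring)
    (f : k[X]) : aeval y f ∈ p.ring := by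
  induction f using Polynomial.induction_on' with
  | add f g hf hg => rw [map_add]; exact p.ring.add_mem _ _ hf hg
  | monomial n a =>
    rw [aeval_monomial]
    exact p.ring.mul_mem _ _ (p.algebraMap_mem a) (pow_mem hy n)

open Polynomial in
theorem FunctionFieldPrime.valuation_aeval_eq_one (p : FunctionFieldPrime k K) {y : K}
    (hy : p.valuation y < 1) {f : k[X]} (hf : f.coeff 0 ≠ 0) : p.valuation (aeval y f) = 1 := by
  rw [← divX_mul_X_add f, map_add, map_mul, aeval_X, aeval_C,
    Valuation.map_add_eq_of_lt_right, p.valuation_algebraMap hf]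
  rw [p.valuation_algebraMap hf, map_mul]
  have := (p.valuation_le_one_iff _).2 (p.aeval_mem_ring ((p.valuation_le_one_iff y).1 hy.le) f.divX)
  exact mul_lt_one_of_nonneg_of_lt_one_right this (zero_le) hy

variable [Algebra k⟮X⟯ K] [IsScalarTower k k⟮X⟯ K] [FunctionField k K]

open Polynomial in
open scoped IntermediateField.algebraAdjoinAdjoin in
/-- The poles of a function at the zeros of `y` are bounded by a power of `y`. -/
theorem exists_pow_mul_mem_ring {y : K} (hy : Transcendental k y) (w : K) :
    ∃ c : ℕ, ∀ q : FunctionFieldPrime k K, q.valuation y < 1 → y ^ c * w ∈ q.ring := by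
  have := finiteDimensional_adjoin_of_transcendental hy
  have : Algebra.IsAlgebraic (Algebra.adjoin k {y}) K :=
    .trans _ (IntermediateField.adjoin k {y}) _
  obtain ⟨r, hr0, hr⟩ := (Algebra.IsAlgebraic.isAlgebraic (R := Algebra.adjoin k {y}) w
    ).exists_integral_multiple
  obtain ⟨f, rfl⟩ := (Polynomial.algEquivOfTranscendental k y hy).surjective r
  have hf0 : f ≠ 0 := by rintro rfl; exact hr0 (map_zero _)
  obtain ⟨g, hg, hg0⟩ := exists_eq_pow_rootMultiplicity_mul_and_not_dvd f hf0 0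
  -- Some `f(y)w` is integral over `k[y]`. Of `f(y)`, only the power of `y` given by the
  -- multiplicity of the root 0 can vanish at a zero of `y`.
  rw [map_zero, sub_zero, X_dvd_iff] at hg0
  refine ⟨rootMultiplicity 0 f, fun q hq => ?_⟩
  have h1 := q.algebraMap_integralClosure_mem ((q.valuation_le_one_iff y).1 hq.le) ⟨_, hr⟩
  have h2 : aeval y f * w ∈ q.ring := by
    convert h1 using 1
    simp [Algebra.smul_def]
  rw [hg, map_mul, map_pow, map_zero, sub_zero, aeval_X] at h2
  rw [← q.valuation_le_one_iff] at h2 ⊢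
  rwa [map_mul, map_mul, q.valuation_aeval_eq_one hq hg0, mul_one, ← map_mul] at h2

variable [CharZero k]

/-- For every prime of a function field, there is a transcendental function whose only pole is at
that prime. -/
theorem exists_transcendental_forall_ne_mem_ring (p : FunctionFieldPrime k K) :
    ∃ f : K, Transcendental k f ∧ ∀ q : FunctionFieldPrime k K, q ≠ p → f ∈ q.ring := by
  obtain ⟨y, -, hy⟩ := SetLike.exists_of_lt (lt_top_iff_ne_top.2 p.ring_ne_top)
  obtain ⟨x, rfl⟩ : ∃ x, x⁻¹ = y := ⟨y⁻¹, inv_inv y⟩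
  have hx : Transcendental k x := transcendental_of_inv_notMem hy
  have hx0 : x ≠ 0 := by rintro rfl; exact hx isAlgebraic_zero
  have hxi : Transcendental k x⁻¹ := by rwa [Transcendental, IsAlgebraic.inv_iff]
  have hxp : p.valuation x < 1 := (p.valuation_lt_one_iff hx0).2 hy
  have := isDedekindDomain_integralClosure_adjoin hx
  have := isFractionRing_integralClosure_adjoin hx
  have := free_integralClosure_adjoin hx
  have := finite_integralClosure_adjoin hx
  set R := Algebra.adjoin k {x} with hR
  let A := integralClosure R K
  let b := Module.Free.chooseBasis R A
  let e := Polynomial.algEquivOfTranscendental k x hx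
  let xA : A := algebraMap R A (e Polynomial.X)
  have hxA : algebraMap A K xA = x := by
    simp [xA, e]
  obtain ⟨Q, hQ⟩ := p.exists_ring_eq_valuationSubring (A := A)
    (p.algebraMap_integralClosure_mem ((p.valuation_le_one_iff x).1 hxp.le))
  have hxQ : xA ∈ Q.asIdeal := by
    rw [← Q.valuation_lt_one_iff_mem (K := K)]
    refine (congrArg (Q.valuation K) hxA).trans_lt ?_
    rw [hQ, Valuation.mem_valuationSubring_iff, map_inv₀, not_le, one_lt_inv₀] at hy
    · exact hy
    · simpa [zero_lt_iff] using hx0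
  obtain ⟨I, hI⟩ : Q.asIdeal ∣ Ideal.span {xA} := by
    rw [Ideal.dvd_span_singleton]; exact hxQ
  choose c hc using fun i => exists_pow_mul_mem_ring hxi (algebraMap A K (b i))
  obtain ⟨d, r, hrI, hr0⟩ := exists_ne_zero_mem_pow_of_basis e b (hI ▸ mul_comm I _)
    Q.isPrime.ne_top (by intro h; exact hx0 (by rw [← hxA]; exact (congrArg _ h).trans (map_zero _)))
    (∑ i, c i + 1)
  set n := d + (∑ i, c i + 1) with hn
  set g : A := ∑ i, ∑ m ∈ Finset.range d, r i m • (xA ^ m * b i) with hg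
  -- Since `m < d`, the factor `x ^ m / x ^ n` absorbs the poles of `b i` and still leaves room for
  -- an extra `x`. This margin also excludes constants: a nonzero constant would make `x` integral
  -- at its own pole.
  have hpole : ∀ q : FunctionFieldPrime k K, x ∉ q.ring →
      algebraMap A K g / x ^ n * x ∈ q.ring := by
    intro q hq
    have hqx : q.valuation x⁻¹ < 1 := (q.valuation_lt_one_iff (inv_ne_zero hx0)).2 (by simpa using hq)
    have hqx' : x⁻¹ ∈ q.ring := (q.valuation_le_one_iff _).1 hqx.le
    have h1 : algebraMap A K g / x ^ n * x = ∑ i, ∑ m ∈ Finset.range d,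
        algebraMap k K (r i m) * (x ^ m * (algebraMap A K (b i)) / x ^ n * x) := by
      rw [hg, map_sum, Finset.sum_div, Finset.sum_mul]
      refine Finset.sum_congr rfl fun i _ => ?_
      rw [map_sum, Finset.sum_div, Finset.sum_mul]
      refine Finset.sum_congr rfl fun m _ => ?_
      rw [Algebra.smul_def, map_mul, map_mul, map_pow, hxA, ← IsScalarTower.algebraMap_apply]
      ring
    rw [h1]
    refine sum_mem fun i _ => sum_mem fun m hm => mul_mem (q.algebraMap_mem _) ?_
    have hci : c i ≤ ∑ i, c i := Finset.single_le_sum (fun _ _ => Nat.zero_le _) (Finset.mem_univ i)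
    have hm := Finset.mem_range.1 hm
    obtain ⟨l, hl⟩ : ∃ l, n = m + c i + l + 1 := ⟨n - (m + c i + 1), by omega⟩
    have h2 : x ^ m * (algebraMap A K (b i)) / x ^ n * x =
        x⁻¹ ^ l * (x⁻¹ ^ c i * algebraMap A K (b i)) := by
      rw [hl, inv_pow, inv_pow, div_mul_eq_mul_div, div_eq_iff (pow_ne_zero _ hx0)]
      field_simp
      ring
    rw [h2]
    exact mul_mem (pow_mem hqx' l) (hc i q hqx)
  refine ⟨algebraMap A K g / x ^ n, ?_, ?_⟩
  · intro halg
    obtain ⟨q, hq⟩ := exists_prime_notMem_of_transcendental hx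
    have h1 := mul_mem (hpole q hq) (q.mem_ring_of_isAlgebraic halg.inv)
    have hg0 : algebraMap A K g ≠ 0 := by
      simpa using hr0
    rw [mul_right_comm, mul_inv_cancel₀ (div_ne_zero hg0 (pow_ne_zero n hx0)), one_mul] at h1
    exact hq h1
  · intro q hqp
    by_cases hq : x ∈ q.ring
    · obtain ⟨Q', hQ'⟩ := q.exists_ring_eq_valuationSubring (A := A)
        (q.algebraMap_integralClosure_mem hq)
      have hne : ¬ Q.asIdeal ≤ Q'.asIdeal := by
        intro h
        have : Q = Q' := HeightOneSpectrum.ext (Q.isMaximal.eq_of_le Q'.isPrime.ne_top h)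
        subst this
        exact hqp (FunctionFieldPrime.ext_ring (hQ'.trans hQ.symm))
      obtain ⟨u, huQ, huQ'⟩ := SetLike.not_le_iff_exists.1 hne
      -- From `Q * I = (x)` comes `Iⁿ * Qⁿ = (xⁿ)`; as `u` is a unit at `Q'`, dividing by `xⁿ`
      -- creates no pole there.
      have h1 : g * u ^ n ∈ Ideal.span {xA ^ n} := by
        rw [← Ideal.span_singleton_pow, hI, mul_comm Q.asIdeal, mul_pow]
        exact Ideal.mul_mem_mul hrI (Ideal.pow_mem_pow huQ n)
      obtain ⟨h, hh⟩ := Ideal.mem_span_singleton.1 h1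
      have hu1 : Q'.valuation K (algebraMap A K u) = 1 :=
        (Q'.valuation_eq_one_iff_notMem).2 huQ'
      have h2 := congrArg (algebraMap A K) hh
      rw [map_mul, map_mul, map_pow, map_pow, hxA] at h2
      have h3 : algebraMap A K g / x ^ n * algebraMap A K u ^ n = algebraMap A K h := by
        rw [div_mul_eq_mul_div, h2, mul_div_cancel_left₀ _ (pow_ne_zero n hx0)]
      rw [hQ', Valuation.mem_valuationSubring_iff]
      have h4 := congrArg (Q'.valuation K) h3
      rw [map_mul, map_pow, hu1, one_pow, mul_one] at h4
      rw [h4]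
      exact Q'.valuation_le_one h
    · have hqx : x⁻¹ ∈ q.ring := (q.ring.mem_or_inv_mem x).resolve_left hq
      have := mul_mem (hpole q hq) hqx
      rwa [mul_assoc, mul_inv_cancel₀ hx0, mul_one] at this

end FunctionField

/-! ### Pell equations under a discrete valuation. -/

section Valuation

variable {K : Type*} [Field K] (v : Valuation K ℤᵐ⁰)

/-- Parity: for nonzero `y` the left side has even order and the right side odd order. -/
theorem Valuation.eq_zero_of_sq_eq_mul_sq {d x y : K} (hd : v d = WithZero.exp (-1))
    (h : v x ^ 2 = v d * v y ^ 2) : y = 0 := by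
  by_contra hy
  have hy' : v y ≠ 0 := by simpa using hy
  have hx : v x ≠ 0 := by
    intro hx
    rw [hx, hd] at h
    simp [hy] at h
  rw [hd] at h
  have := congrArg WithZero.log h
  rw [WithZero.log_mul (by simp) (pow_ne_zero 2 hy'), WithZero.log_pow, WithZero.log_pow,
    WithZero.log_exp] at this
  simp only [nsmul_eq_mul, Nat.cast_ofNat] at this
  omega

/-- Solutions of a Pell equation are integral at the places where the discriminant has
order one. -/
theorem Valuation.le_one_of_pell {d x y : K} (hd : v d = WithZero.exp (-1))
    (h : x ^ 2 - d * y ^ 2 = 1) : v x ≤ 1 ∧ v y ≤ 1 := by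
  have hx : x ^ 2 = 1 + d * y ^ 2 := by linear_combination h
  have hd1 : v d ≤ 1 := by rw [hd, ← WithZero.exp_zero, WithZero.exp_le_exp]; norm_num
  have hy : v y ≤ 1 := by
    by_contra! hy
    have hlt : v 1 < v (d * y ^ 2) := by
      have hy0 : v y ≠ 0 := (zero_lt_one.trans hy).ne'
      rw [map_one, map_mul, map_pow, hd]
      rw [← WithZero.exp_log hy0] at hy ⊢
      rw [← WithZero.exp_zero, WithZero.exp_lt_exp] at hy
      rw [← WithZero.exp_nsmul, ← WithZero.exp_add, ← WithZero.exp_zero, WithZero.exp_lt_exp]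
      simp only [nsmul_eq_mul, Nat.cast_ofNat]
      omega
    have h1 : v x ^ 2 = v d * v y ^ 2 := by
      rw [← map_pow, hx, Valuation.map_add_eq_of_lt_right _ hlt, map_mul, map_pow]
    rw [v.eq_zero_of_sq_eq_mul_sq hd h1, map_zero] at hy
    exact not_lt_zero hy
  refine ⟨?_, hy⟩
  rw [← pow_le_one_iff_of_nonneg zero_le (two_ne_zero), ← map_pow, hx]
  refine (v.map_add _ _).trans (max_le (map_one v).le ?_)
  rw [map_mul, map_pow]
  exact mul_le_one' hd1 (pow_le_one' hy 2)

open Polynomial.Chebyshev in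
/-- The solutions of the Pell equation `x² - (a² - 1) y² = 1` in a ring on which a nonarchimedean
valuation is nowhere small are given by the Chebyshev polynomials. -/
theorem Valuation.pell_eq_chebyshev (hv2 : v 2 = 1) (A : Subring K)
    (hA : ∀ f ∈ A, f ≠ 0 → 1 ≤ v f) {a : K} (ha : a ∈ A) (hav : 1 < v a) {x y : K} (hx : x ∈ A)
    (hy : y ∈ A) (h : x ^ 2 - (a ^ 2 - 1) * y ^ 2 = 1) :
    ∃ n : ℤ, y = (U K (n - 1)).eval a ∧ (x = (T K n).eval a ∨ x = -(T K n).eval a) := by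
  -- Descent on the pole order of `y`; below the bound for `N = 0` nothing but `y = 0` remains.
  obtain ⟨N, hN⟩ : ∃ N : ℕ, v y < WithZero.exp (N : ℤ) := by
    by_cases hy0 : v y = 0
    · exact ⟨0, by simp [hy0]⟩
    · refine ⟨(WithZero.log (v y)).toNat + 1, ?_⟩
      rw [← WithZero.log_lt_iff_lt_exp hy0]
      omega
  induction N generalizing x y with
  | zero =>
    have hy0 : y = 0 := by
      by_contra hy0
      exact (hA y hy hy0).not_gt (by simpa using hN)
    subst hy0
    refine ⟨0, by simp, ?_⟩
    have : x ^ 2 = 1 := by simpa using h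
    simpa using this
  | succ N ih =>
    by_cases hy0 : y = 0
    · subst hy0
      refine ⟨0, by simp, ?_⟩
      have : x ^ 2 = 1 := by simpa using h
      simpa using this
    have hy1 := hA y hy hy0
    -- If `ay + x` is at least as large as `ay`, then `(ay - x)(ay + x) = y² - 1` makes `ay - x`
    -- smaller than `y`. With `δ² = a² - 1`, the descent multiplies `x + yδ` by `a - δ`.
    have key : ∀ x ∈ A, x ^ 2 - (a ^ 2 - 1) * y ^ 2 = 1 → v (a * y) ≤ v (a * y + x) →
        ∃ n : ℤ, y = (U K (n - 1)).eval a ∧ (x = (T K n).eval a ∨ x = -(T K n).eval a) := by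
      intro x hx h hle
      have h1 : v (a * y - x) * v a ≤ v y := by
        have h2 : v (a * y - x) * v (a * y + x) ≤ v y * v y := by
          rw [← map_mul, show (a * y - x) * (a * y + x) = y * y - 1 by linear_combination -h]
          refine (v.map_sub _ _).trans (max_le (map_mul v y y).le ?_)
          rw [map_one]
          exact one_le_mul hy1 hy1
        have h3 := (mul_le_mul_right hle (v (a * y - x))).trans h2
        rw [map_mul, ← mul_assoc] at h3
        exact (mul_le_mul_iff_of_pos_right (zero_lt_one.trans_le hy1)).1 h3
      have h4 : v (a * y - x) < v y := by
        by_contra! hge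
        have h5 : v y * v a ≤ v y * 1 := by
          rw [mul_one]
          exact (mul_le_mul_left hge _).trans h1
        exact hav.not_ge ((mul_le_mul_iff_of_pos_left (zero_lt_one.trans_le hy1)).1 h5)
      have h5 : v (a * y - x) < WithZero.exp (N : ℤ) := by
        refine h4.trans_le ?_
        have hy0 : v y ≠ 0 := by simpa using hy0
        rw [← WithZero.log_lt_iff_lt_exp hy0] at hN
        rw [← WithZero.log_le_iff_le_exp hy0]
        push_cast at hN
        omega
      have hd : a ^ 2 - 1 ∈ A := sub_mem (pow_mem ha 2) (one_mem A)
      obtain ⟨n, hn1, hn2⟩ := ih (x := a * x - (a ^ 2 - 1) * y) (y := a * y - x)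
        (sub_mem (mul_mem ha hx) (mul_mem hd hy)) (sub_mem (mul_mem ha hy) hx)
        (by linear_combination h) h5
      have hU : (U K n).eval a = a * (U K (n - 1)).eval a + (T K n).eval a := by
        have := congrArg (Polynomial.eval a) (U_eq_X_mul_U_add_T K (n - 1))
        simpa using this
      have hU' : (U K (n - 2)).eval a = a * (U K (n - 1)).eval a - (T K n).eval a := by
        have := congrArg (Polynomial.eval a) (U_sub_two K n)
        simp only [Polynomial.eval_sub, Polynomial.eval_mul, Polynomial.eval_X,
          Polynomial.eval_ofNat] at this
        rw [this, hU]; ring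
      have hT : (T K (n + 1)).eval a = a * (T K n).eval a + (a ^ 2 - 1) * (U K (n - 1)).eval a := by
        have := congrArg (Polynomial.eval a) (T_eq_X_mul_T_sub_pol_U K (n - 1))
        rw [show n - 1 + 2 = n + 1 by ring, sub_add_cancel] at this
        rw [this]
        simp only [Polynomial.eval_sub, Polynomial.eval_mul, Polynomial.eval_X,
          Polynomial.eval_one, Polynomial.eval_pow]
        ring
      have hT' : (T K (n - 1)).eval a = a * (T K n).eval a - (a ^ 2 - 1) * (U K (n - 1)).eval a := by
        have := congrArg (Polynomial.eval a) (T_sub_one K n)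
        simp only [Polynomial.eval_sub, Polynomial.eval_mul, Polynomial.eval_X,
          Polynomial.eval_ofNat] at this
        rw [this, hT]; ring
      rcases hn2 with hn2 | hn2
      · refine ⟨n + 1, ?_, Or.inl ?_⟩
        · rw [add_sub_cancel_right, hU, ← hn1, ← hn2]; ring
        · rw [hT, ← hn1, ← hn2]; ring
      · have hn3 : (T K n).eval a = -(a * x - (a ^ 2 - 1) * y) := by rw [hn2, neg_neg]
        refine ⟨n - 1, ?_, Or.inr ?_⟩
        · rw [show n - 1 - 1 = n - 2 by ring, hU', ← hn1, hn3]; ring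
        · rw [hT', ← hn1, hn3]; ring
    -- The sum of `ay - x` and `ay + x` is `2ay`, and `v 2 = 1`, so the larger of the two is at
    -- least as large as `ay`; replacing `x` by `-x` interchanges the cases.
    rcases le_total (v (a * y - x)) (v (a * y + x)) with hle | hle
    · refine key x hx h ?_
      have h1 := v.map_add (a * y - x) (a * y + x)
      rwa [show a * y - x + (a * y + x) = 2 * (a * y) by ring, map_mul, hv2, one_mul,
        max_eq_right hle] at h1
    · obtain ⟨n, hn1, hn2⟩ := key (-x) (neg_mem hx) (by linear_combination h) (by
        have h1 := v.map_add (a * y - x) (a * y + x)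
        rwa [show a * y - x + (a * y + x) = 2 * (a * y) by ring, map_mul, hv2, one_mul,
          max_eq_left hle, sub_eq_add_neg] at h1)
      exact ⟨n, hn1, hn2.symm.imp neg_inj.1 neg_eq_iff_eq_neg.1⟩

end Valuation

/-! ### Single-fold systems and the Chebyshev congruences. -/

section SingleFold

/-- A system of equations over a domain with an anisotropic form `u² - c v²` is equivalent to a
single equation. -/
theorem MvPolynomial.exists_eval_eq_zero_iff_forall {R σ ι : Type*} [CommRing R] [IsDomain R]
    {c : R} (hc : ∀ u v : R, u ^ 2 = c * v ^ 2 → v = 0) (s : Finset ι)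
    (g : ι → MvPolynomial σ R) :
    ∃ f : MvPolynomial σ R, ∀ x : σ → R, eval x f = 0 ↔ ∀ i ∈ s, eval x (g i) = 0 := by
  classical
  induction s using Finset.induction_on with
  | empty => exact ⟨0, by simp⟩
  | insert i s _ ih =>
    obtain ⟨f, hf⟩ := ih
    refine ⟨f ^ 2 - C c * g i ^ 2, fun x => ?_⟩
    rw [Finset.forall_mem_insert, ← hf x]
    simp only [map_sub, map_mul, map_pow, eval_C, sub_eq_zero]
    constructor
    · intro h
      have h1 := hc _ _ h
      rw [h1] at h
      exact ⟨h1, by simpa using h⟩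
    · rintro ⟨h1, h2⟩
      simp [h1, h2]

/-- A set defined with unique witnesses by a finite system of equations has a single-fold
Diophantine definition. -/
theorem HasSingleFoldDefinition.of_system {R σ ι : Type*} [CommRing R] [IsDomain R] {n : ℕ}
    {A : Set (Fin n → R)} [Fintype σ] [Nonempty σ] [Fintype ι] {c : R}
    (hc : ∀ u v : R, u ^ 2 = c * v ^ 2 → v = 0) (g : ι → MvPolynomial (Fin n ⊕ σ) R)
    (h1 : ∀ t (x : σ → R), (∀ i, MvPolynomial.eval (Sum.elim t x) (g i) = 0) → t ∈ A)
    (h2 : ∀ t ∈ A, ∃! x : σ → R, ∀ i, MvPolynomial.eval (Sum.elim t x) (g i) = 0) :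
    HasSingleFoldDefinition A := by
  obtain ⟨f, hf⟩ := MvPolynomial.exists_eval_eq_zero_iff_forall hc Finset.univ g
  let e := Fintype.equivFin σ
  have hev : ∀ (t : Fin n → R) (x : Fin (Fintype.card σ) → R),
      MvPolynomial.eval (Sum.elim t x) (MvPolynomial.rename (Sum.map id e) f) = 0 ↔
        ∀ i, MvPolynomial.eval (Sum.elim t (x ∘ e)) (g i) = 0 := by
    intro t x
    rw [MvPolynomial.eval_rename, Sum.elim_comp_map, Function.comp_id, hf]
    simp
  have huniq : ∀ t ∈ A, ∃! x : Fin (Fintype.card σ) → R,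
      MvPolynomial.eval (Sum.elim t x) (MvPolynomial.rename (Sum.map id e) f) = 0 := by
    intro t ht
    obtain ⟨x, hx, hxu⟩ := h2 t ht
    refine ⟨x ∘ e.symm, (hev _ _).2 ?_, fun y hy => ?_⟩
    · simpa [Function.comp_assoc] using hx
    · rw [← hxu _ ((hev _ _).1 hy)]
      simp [Function.comp_assoc]
  exact ⟨Fintype.card σ, Fintype.card_pos, _,
    fun t => ⟨fun ht => (huniq t ht).exists, fun ⟨x, hx⟩ => h1 t _ ((hev t x).1 hx)⟩, huniq⟩

/-- In a domain, the first equation says that `a` is zero or a unit; the second forces the witness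
to be 0 when `a = 0`, where it would otherwise be arbitrary. -/
theorem eq_of_generalized_inverse {R : Type*} [CommRing R] {a y z : R} (h1 : a ^ 2 * y = a)
    (h2 : a * y ^ 2 = y) (h3 : a ^ 2 * z = a) (h4 : a * z ^ 2 = z) : y = z := by
  have h : a * y = a * z := by linear_combination y * -h3 + z * h1
  calc y = a * y * y := by linear_combination -h2
    _ = a * z * z := by rw [h, mul_assoc, mul_comm z y, ← mul_assoc, h]
    _ = z := by linear_combination h4

open Polynomial.Chebyshev in
theorem Polynomial.Chebyshev.T_sq_sub_mul_U_sq (R : Type*) [CommRing R] (n : ℤ) :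
    T R n ^ 2 - (X ^ 2 - 1) * U R (n - 1) ^ 2 = 1 := by
  have h1 := T_eq_X_mul_T_sub_pol_U R
  have h2 := U_eq_X_mul_U_add_T R
  induction n using Int.induction_on with
  | zero => simp
  | succ n ih =>
    have h3 := h1 (n - 1)
    have h4 := h2 (n - 1)
    rw [show (n : ℤ) - 1 + 2 = n + 1 by ring, sub_add_cancel] at h3
    rw [sub_add_cancel] at h4
    rw [add_sub_cancel_right, h3, h4]
    linear_combination ih
  | pred n ih =>
    have h3 := h1 (-n - 1 - 1)
    have h4 := h2 (-n - 1 - 1)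
    rw [show -(n : ℤ) - 1 - 1 + 2 = -n by ring, sub_add_cancel] at h3
    rw [sub_add_cancel] at h4
    rw [h3, h4] at ih
    linear_combination ih

open Polynomial.Chebyshev in
/-- The integers are single-fold definable in a domain with a Pell equation whose only
solutions are the Chebyshev ones. -/
theorem hasSingleFoldDefinition_rationalIntegers {R : Type*} [CommRing R] [IsDomain R]
    (e : R) (N : ℕ) (hform : ∀ u v : R, u ^ 2 = e * v ^ 2 → v = 0) (he0 : e ≠ 0)
    (hunit : ∀ z : ℤ, z ≠ 0 → IsUnit (z : R)) (he : ¬ IsUnit e)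
    (hconst : ∀ t : R, (∀ i ≤ N, ∃ y, (t + (i : R)) ^ 2 * y = t + i) → ∀ z : ℤ,
      e ∣ t - z → t = z)
    (hpell : ∀ x y : R, x ^ 2 - ((1 + e) ^ 2 - 1) * y ^ 2 = 1 → ∃ n : ℤ,
      y = (U R (n - 1)).eval (1 + e) ∧ (x = (T R n).eval (1 + e) ∨ x = -(T R n).eval (1 + e))) :
    HasSingleFoldDefinition (rationalIntegers R) := by
  have hint : ∀ z : ℤ, e ∣ (z : R) → z = 0 := by
    intro z hz
    by_contra hz0
    exact he (isUnit_of_dvd_unit hz (hunit z hz0))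
  have hU : ∀ n : ℤ, e ∣ (U R (n - 1)).eval (1 + e) - n := by
    intro n
    have := Polynomial.sub_dvd_eval_sub (1 + e) 1 (U R (n - 1))
    simpa using this
  have hT : ∀ n : ℤ, e ∣ (T R n).eval (1 + e) - 1 := by
    intro n
    have := Polynomial.sub_dvd_eval_sub (1 + e) 1 (T R n)
    simpa using this
  have hsol : ∀ t w z : R, (1 + e * w) ^ 2 - ((1 + e) ^ 2 - 1) * (t + e * z) ^ 2 = 1 →
      ∃ n : ℤ, e ∣ t - n ∧ t + e * z = (U R (n - 1)).eval (1 + e) ∧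
        1 + e * w = (T R n).eval (1 + e) := by
    intro t w z h
    obtain ⟨n, hn1, hn2⟩ := hpell _ _ h
    refine ⟨n, ?_, hn1, hn2.resolve_right fun hn2 => ?_⟩
    · have h1 := dvd_sub (hU n) (dvd_mul_right e z)
      rw [← hn1] at h1
      convert h1 using 1
      ring
    -- The wrong sign would give `1 ≡ -1` modulo `e`, making `e` a divisor of the unit 2.
    · have h1 : e ∣ ((2 : ℤ) : R) := by
        have h2 := dvd_add (hT n) (dvd_mul_right e w)
        rw [← dvd_neg]
        convert h2 using 1
        push_cast
        linear_combination -hn2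
      exact absurd (hint 2 h1) two_ne_zero
  let t : MvPolynomial (Fin 1 ⊕ (Fin (N + 1) ⊕ Fin 2)) R := MvPolynomial.X (.inl 0)
  let y : Fin (N + 1) → MvPolynomial (Fin 1 ⊕ (Fin (N + 1) ⊕ Fin 2)) R :=
    fun i => MvPolynomial.X (.inr (.inl i))
  let w : Fin 2 → MvPolynomial (Fin 1 ⊕ (Fin (N + 1) ⊕ Fin 2)) R :=
    fun i => MvPolynomial.X (.inr (.inr i))
  let E := MvPolynomial.C (σ := Fin 1 ⊕ (Fin (N + 1) ⊕ Fin 2)) e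
  let g : (Fin (N + 1) ⊕ Fin (N + 1)) ⊕ Unit → MvPolynomial (Fin 1 ⊕ (Fin (N + 1) ⊕ Fin 2)) R :=
    Sum.elim (Sum.elim (fun i => (t + (i : ℕ)) ^ 2 * y i - (t + (i : ℕ)))
      (fun i => (t + (i : ℕ)) * y i ^ 2 - y i))
      (fun _ => (1 + E * w 0) ^ 2 - ((1 + E) ^ 2 - 1) * (t + E * w 1) ^ 2 - 1)
  have hg : ∀ (s : Fin 1 → R) (x : Fin (N + 1) ⊕ Fin 2 → R),
      (∀ i, MvPolynomial.eval (Sum.elim s x) (g i) = 0) ↔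
        (∀ i : Fin (N + 1), (s 0 + (i : ℕ)) ^ 2 * x (.inl i) = s 0 + (i : ℕ) ∧
          (s 0 + (i : ℕ)) * x (.inl i) ^ 2 = x (.inl i)) ∧
        (1 + e * x (.inr 0)) ^ 2 - ((1 + e) ^ 2 - 1) * (s 0 + e * x (.inr 1)) ^ 2 = 1 := by
    intro s x
    simp [g, t, y, w, E, sub_eq_zero, Sum.forall, forall_and]
  have hfinal : ∀ (s : Fin 1 → R) (x : Fin (N + 1) ⊕ Fin 2 → R),
      (∀ i, MvPolynomial.eval (Sum.elim s x) (g i) = 0) → ∃ n : ℤ, s 0 = n ∧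
        s 0 + e * x (.inr 1) = (U R (n - 1)).eval (1 + e) ∧
        1 + e * x (.inr 0) = (T R n).eval (1 + e) := by
    intro s x h
    rw [hg] at h
    obtain ⟨n, hn1, hn2, hn3⟩ := hsol _ _ _ h.2
    exact ⟨n, hconst _ (fun i hi => ⟨_, (h.1 ⟨i, by omega⟩).1⟩) n hn1, hn2, hn3⟩
  have hcast : ∀ m n : ℤ, (m : R) = n → m = n := by
    intro m n h
    rw [← sub_eq_zero]
    refine hint _ ?_
    simp [h]
  refine .of_system hform g (fun s x h => ?_) ?_
  · obtain ⟨n, hn, -⟩ := hfinal s x h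
    exact ⟨n, hn⟩
  · rintro s ⟨n, hn⟩
    have hex : ∀ i : Fin (N + 1), ∃ y : R, (s 0 + (i : ℕ)) ^ 2 * y = s 0 + (i : ℕ) ∧
        (s 0 + (i : ℕ)) * y ^ 2 = y := by
      intro i
      have h1 : s 0 + (i : ℕ) = ((n + (i : ℕ) : ℤ) : R) := by rw [hn]; push_cast; rfl
      rw [h1]
      by_cases h0 : n + (i : ℕ) = 0
      · exact ⟨0, by simp [h0]⟩
      · obtain ⟨u, hu⟩ := hunit _ h0
        rw [← hu]
        exact ⟨(u⁻¹ : Rˣ), by rw [sq, mul_assoc, Units.mul_inv, mul_one],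
          by rw [sq, ← mul_assoc, Units.mul_inv, one_mul]⟩
    choose y hy using hex
    obtain ⟨z, hz⟩ := hU n
    obtain ⟨w, hw⟩ := hT n
    refine ⟨Sum.elim y ![w, z], (hg _ _).2 ⟨by simpa using hy, ?_⟩, fun x hx => ?_⟩
    · have h := congrArg (Polynomial.eval (1 + e))
        (Polynomial.Chebyshev.T_sq_sub_mul_U_sq R n)
      simp only [Polynomial.eval_sub, Polynomial.eval_mul, Polynomial.eval_pow,
        Polynomial.eval_X, Polynomial.eval_one] at h
      simp only [Sum.elim_inr, Matrix.cons_val_zero, Matrix.cons_val_one]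
      rw [hn, ← hz, ← hw, add_sub_cancel, add_sub_cancel, h]
    · obtain ⟨m, hm1, hm2, hm3⟩ := hfinal s x hx
      obtain rfl : m = n := hcast _ _ (hm1.symm.trans hn)
      have hx' := ((hg s x).1 hx).1
      funext i
      rcases i with i | i
      · exact eq_of_generalized_inverse (hx' i).1 (hx' i).2 (hy i).1 (hy i).2
      · apply mul_left_cancel₀ he0
        fin_cases i
        · simp only [Fin.zero_eta, Sum.elim_inr, Matrix.cons_val_zero]
          linear_combination hm3 + hw
        · simp only [Fin.mk_one, Sum.elim_inr, Matrix.cons_val_one, Matrix.cons_val_fin_one]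
          linear_combination hm2 + hz - hn

end SingleFold

/-! ### Prescribed simple zeros, and zeros of integer translates. -/

section FunctionField

variable {k K : Type*} [Field k] [Field K] [Algebra k K]

theorem FunctionFieldPrime.valuation_eq_one_of_isAlgebraic (p : FunctionFieldPrime k K) {x : K}
    (hx : IsAlgebraic k x) (hx0 : x ≠ 0) : p.valuation x = 1 := by
  refine le_antisymm ((p.valuation_le_one_iff _).2 (p.mem_ring_of_isAlgebraic hx)) ?_
  rw [← inv_le_one₀ (by simpa [zero_lt_iff] using hx0), ← map_inv₀, p.valuation_le_one_iff]
  exact p.mem_ring_of_isAlgebraic hx.inv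

theorem FunctionFieldPrime.valuation_intCast [CharZero k] (p : FunctionFieldPrime k K) {z : ℤ}
    (hz : z ≠ 0) : p.valuation (z : K) = 1 := by
  rw [← map_intCast (algebraMap k K)]
  exact p.valuation_algebraMap (Int.cast_ne_zero.2 hz)

/-- Both valuations are normalized with the same valuation ring, so they have the same uniformizers.
-/
theorem FunctionFieldPrime.valuation_eq_exp_neg_one (p : FunctionFieldPrime k K) {A : Type*}
    [CommRing A] [IsDedekindDomain A] [Algebra A K] [IsFractionRing A K] {Q : HeightOneSpectrum A}
    (hQ : p.ring = (Q.valuation K).valuationSubring) {e : K}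
    (he : Q.valuation K e = WithZero.exp (-1)) : p.valuation e = WithZero.exp (-1) := by
  have heq : p.valuation.IsEquiv (Q.valuation K) := by
    rw [Valuation.isEquiv_iff_val_le_one]
    intro x
    rw [p.valuation_le_one_iff, hQ, Valuation.mem_valuationSubring_iff]
  have hlt : ∀ a : ℤᵐ⁰, a < 1 ↔ a ≤ WithZero.exp (-1) := by
    intro a
    by_cases ha : a = 0
    · simp [ha]
    · rw [← WithZero.exp_log ha, ← WithZero.exp_zero, WithZero.exp_lt_exp, WithZero.exp_le_exp]
      omega
  obtain ⟨x, hx⟩ := (IsDiscreteValuationRing.maximalIdeal p.ring).valuation_exists_uniformizer K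
  have hx : p.valuation x = WithZero.exp (-1) := hx
  apply le_antisymm
  · rw [← hlt, heq.lt_one_iff_lt_one, hlt, he]
  · rw [← hx, heq.le_iff_le, he, ← hlt, ← heq.lt_one_iff_lt_one, hlt, hx]

theorem mem_sIntegers_iff {S : Set (FunctionFieldPrime k K)} {x : K} :
    x ∈ sIntegers S ↔ ∀ p ∉ S, x ∈ p.ring :=
  forall₂_congr fun p _ => p.valuation_le_one_iff x

variable [CharZero k] [Algebra k⟮X⟯ K] [IsScalarTower k k⟮X⟯ K] [FunctionField k K]

/-- There is a function without poles outside a given prime, which has a simple zero at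
finitely many other prescribed primes. -/
theorem exists_valuation_eq_exp_neg_one (p : FunctionFieldPrime k K)
    (s : Finset {q : FunctionFieldPrime k K // q ≠ p}) :
    ∃ e ∈ sIntegers {p}, ∀ q ∈ s, q.1.valuation e = WithZero.exp (-1) := by
  obtain ⟨T, hT, hTp⟩ := exists_transcendental_forall_ne_mem_ring p
  have := isDedekindDomain_integralClosure_adjoin hT
  have := isFractionRing_integralClosure_adjoin hT
  set A := integralClosure (Algebra.adjoin k {T}) K
  have hA := fun q : {q : FunctionFieldPrime k K // q ≠ p} =>
    q.1.algebraMap_integralClosure_mem (hTp q.1 q.2)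
  choose Q hQ using fun q : {q : FunctionFieldPrime k K // q ≠ p} =>
    q.1.exists_ring_eq_valuationSubring (A := A) (hA q)
  choose u hu using fun q => (Q q).intValuation_exists_uniformizer
  -- Congruence to a uniformizer modulo the square of the prime makes the zero simple.
  obtain ⟨e, he⟩ := IsDedekindDomain.exists_forall_sub_mem_ideal (s := s)
    (fun q => (Q q).asIdeal) (fun _ => 2) (fun q _ => (Q q).prime)
    (fun q _ q' _ hne h => hne (Subtype.ext (FunctionFieldPrime.ext_ring (by
      rw [hQ q, hQ q', HeightOneSpectrum.ext h])))) (fun q => u q)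
  refine ⟨algebraMap A K e, mem_sIntegers_iff.2 fun q hq => hA ⟨q, hq⟩ e, fun q hq => ?_⟩
  refine q.1.valuation_eq_exp_neg_one (hQ q) ?_
  have h1 := ((Q q).intValuation_le_pow_iff_mem _ 2).2 (he q hq)
  have h2 : (Q q).intValuation (e - u q) < (Q q).intValuation (u q) := by
    rw [hu]
    exact h1.trans_lt (by rw [WithZero.exp_lt_exp]; norm_num)
  rw [HeightOneSpectrum.valuation_of_algebraMap, ← sub_add_cancel e (u q),
    Valuation.map_add_eq_of_lt_right _ h2, hu]

/-- A transcendental function has an integer translate with a zero outside a given finite set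
of primes. -/
theorem exists_add_natCast_inv_notMem {S : Set (FunctionFieldPrime k K)} (hS : S.Finite) {x : K}
    (hx : Transcendental k x) :
    ∃ i ≤ S.ncard, ∃ q ∉ S, (x + (i : K))⁻¹ ∉ q.ring := by
  have htr : ∀ i : ℕ, Transcendental k (x + (i : K)) := by
    intro i h
    have := h.sub (isAlgebraic_algebraMap (A := K) (i : k))
    rw [map_natCast, add_sub_cancel_right] at this
    exact hx this
  have hp : ∀ i : ℕ, ∃ q : FunctionFieldPrime k K, (x + (i : K))⁻¹ ∉ q.ring := by
    intro i
    refine exists_prime_notMem_of_transcendental ?_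
    rw [Transcendental, IsAlgebraic.inv_iff]
    exact htr i
  choose q hq using hp
  by_contra! hall
  have hmem : ∀ i ∈ Finset.range (S.ncard + 1), q i ∈ hS.toFinset := by
    intro i hi
    rw [Set.Finite.mem_toFinset]
    by_contra h
    exact hq i (hall i (by simpa [Nat.lt_succ_iff] using hi) _ h)
  obtain ⟨i, -, j, -, hij, hqij⟩ := Finset.exists_ne_map_eq_of_card_lt_of_maps_to
    (by rw [Finset.card_range, Set.ncard_eq_toFinset_card S hS]; exact Nat.lt_succ_self _) hmem
  have hlt : ∀ i, (q i).valuation (x + (i : K)) < 1 := fun i =>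
    ((q i).valuation_lt_one_iff (by
      intro h; exact htr i (h ▸ isAlgebraic_zero))).2 (hq i)
  -- A common zero of two translates would be a zero of the nonzero integer `i - j`.
  have h1 := (q i).valuation.map_sub_lt (hlt i) (by rw [hqij]; exact hlt j)
  have h2 := (q i).valuation_intCast (z := (i : ℤ) - j) (by omega)
  push_cast at h2
  rw [add_sub_add_left_eq_sub, h2] at h1
  exact lt_irrefl _ h1

end FunctionField

/-! ### The definition over the `S`-integers. -/

open Polynomial.Chebyshev in
theorem mainTheorem5 {k K : Type*} [Field k] [CharZero k] [Field K] [Algebra k K]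
    [Algebra k⟮X⟯ K] [IsScalarTower k k⟮X⟯ K] [FunctionField k K]
    (S : Set (FunctionFieldPrime k K)) (hfin : S.Finite) (hne : S.Nonempty) :
    HasSingleFoldDefinition (rationalIntegers (sIntegers S)) := by
  obtain ⟨p, hpS⟩ := hne
  obtain ⟨f, hf, -⟩ := exists_transcendental_forall_ne_mem_ring p
  -- Only the existence of a prime outside `S` is needed here.
  obtain ⟨-, -, r, hrS, -⟩ := exists_add_natCast_inv_notMem hfin hf
  have hrp : r ≠ p := by rintro rfl; exact hrS hpS
  obtain ⟨e, hep, hes⟩ := exists_valuation_eq_exp_neg_one p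
    (((hfin.insert r).preimage Subtype.val_injective.injOn).toFinset)
  have her : r.valuation e = WithZero.exp (-1) := hes ⟨r, hrp⟩ (by simp)
  have heS : ∀ q ∈ S, q ≠ p → q.valuation e = WithZero.exp (-1) :=
    fun q hq hqp => hes ⟨q, hqp⟩ (by simp [hq])
  have hlt : WithZero.exp (-1 : ℤ) < 1 := by
    rw [← WithZero.exp_zero, WithZero.exp_lt_exp]; norm_num
  have he0 : e ≠ 0 := by
    rintro rfl
    rw [map_zero] at her
    exact WithZero.exp_ne_zero her.symm
  have hetr : Transcendental k e := fun h => hlt.ne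
    (her.symm.trans (r.valuation_eq_one_of_isAlgebraic h he0))
  have hsub : sIntegers {p} ≤ sIntegers S := fun x hx => mem_sIntegers_iff.2 fun q hq =>
    mem_sIntegers_iff.1 hx q (by rintro rfl; exact hq hpS)
  have hpe : 1 < p.valuation e := by
    obtain ⟨q, hq⟩ := exists_prime_notMem_of_transcendental hetr
    obtain rfl : q = p := by
      by_contra h
      exact hq (mem_sIntegers_iff.1 hep q h)
    rwa [← q.valuation_le_one_iff, not_le] at hq
  have hR : ∀ f : sIntegers S, r.valuation (f : K) ≤ 1 := fun f => f.2 r hrS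
  have hp2 : p.valuation 2 = 1 := by
    simpa using p.valuation_intCast (z := 2) two_ne_zero
  refine hasSingleFoldDefinition_rationalIntegers (⟨e, hsub hep⟩ : sIntegers S) S.ncard ?_ ?_ ?_ ?_
    ?_ ?_
  · intro u v h
    have h1 := congrArg (fun x : sIntegers S => r.valuation (x : K)) h
    simp only [Subring.coe_mul, Subring.coe_pow, map_mul, map_pow] at h1
    exact Subtype.ext (r.valuation.eq_zero_of_sq_eq_mul_sq her h1)
  · exact fun h => he0 (congrArg Subtype.val h)
  · intro z hz
    have hz' : (z : K) ≠ 0 := by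
      rw [← map_intCast (algebraMap k K), map_ne_zero]
      exact Int.cast_ne_zero.2 hz
    refine IsUnit.of_mul_eq_one ⟨(z : K)⁻¹, fun q _ => ?_⟩ (Subtype.ext ?_)
    · rw [map_inv₀, q.valuation_intCast hz, inv_one]
    · simpa using mul_inv_cancel₀ hz'
  · intro h
    obtain ⟨b, hb⟩ := h.exists_right_inv
    have h1 := congrArg (fun x : sIntegers S => r.valuation (x : K)) hb
    simp only [Subring.coe_mul, map_mul, Subring.coe_one, map_one, her] at h1
    exact (mul_lt_one_of_lt_of_le hlt (hR b)).ne h1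
  · rintro t ht z ⟨b, hb⟩
    have halg : IsAlgebraic k (t : K) := by
      by_contra htr
      obtain ⟨i, hi, q, hq, hqi⟩ := exists_add_natCast_inv_notMem hfin htr
      obtain ⟨y, hy⟩ := ht i hi
      apply hqi
      have hy' := congrArg (fun x : sIntegers S => (x : K)) hy
      simp only [Subring.coe_mul, Subring.coe_pow, Subring.coe_add, Subring.coe_natCast] at hy'
      have h0 : (t : K) + (i : K) ≠ 0 := by
        intro h0
        rw [h0, inv_zero] at hqi
        exact hqi q.ring.zero_mem
      have h1 : ((t : K) + (i : K))⁻¹ = y := by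
        apply inv_eq_of_mul_eq_one_right
        apply mul_left_cancel₀ h0
        linear_combination hy'
      rw [h1]
      exact mem_sIntegers_iff.1 y.2 q hq
    have hb' := congrArg (fun x : sIntegers S => (x : K)) hb
    simp only [Subring.coe_mul, AddSubgroupClass.coe_sub, Subring.coe_intCast] at hb'
    apply Subtype.ext
    rw [← sub_eq_zero, Subring.coe_intCast]
    by_contra h0
    -- A nonzero constant has order 0 at `r`, whereas a multiple of `e` in the ring vanishes there.
    have h1 := r.valuation_eq_one_of_isAlgebraic
      (halg.sub (by simpa using isAlgebraic_algebraMap (A := K) (z : k))) h0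
    rw [hb', map_mul, her] at h1
    exact (mul_lt_one_of_lt_of_le hlt (hR b)).ne h1
  · intro x y h
    have h' : (x : K) ^ 2 - ((1 + e) ^ 2 - 1) * (y : K) ^ 2 = 1 := by
      simpa using congrArg (fun x : sIntegers S => (x : K)) h
    have hmem : (x : K) ∈ sIntegers {p} ∧ (y : K) ∈ sIntegers {p} := by
      rw [mem_sIntegers_iff, mem_sIntegers_iff, ← forall₂_and]
      intro q hqp
      by_cases hq : q ∈ S
      · have hqe := heS q hq hqp
        have hq2 : q.valuation (e + 2) = 1 := by
          have h2 : q.valuation 2 = 1 := by simpa using q.valuation_intCast (z := 2) two_ne_zero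
          rw [Valuation.map_add_eq_of_lt_right, h2]
          rw [hqe, h2]; exact hlt
        have hd : q.valuation ((1 + e) ^ 2 - 1) = WithZero.exp (-1) := by
          rw [show (1 + e) ^ 2 - 1 = e * (e + 2) by ring, map_mul, hqe, hq2, mul_one]
        have := q.valuation.le_one_of_pell hd h'
        rwa [q.valuation_le_one_iff, q.valuation_le_one_iff] at this
      · exact ⟨mem_sIntegers_iff.1 x.2 q hq, mem_sIntegers_iff.1 y.2 q hq⟩
    -- A zero at `p` would make `f` transcendental, hence with a pole somewhere, yet `p` was the
    -- only candidate.
    have hA : ∀ f ∈ sIntegers {p}, f ≠ 0 → 1 ≤ p.valuation f := by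
      intro f hf hf0
      by_contra! hlt
      have htr := transcendental_of_inv_notMem ((p.valuation_lt_one_iff hf0).1 hlt)
      obtain ⟨q, hq⟩ := exists_prime_notMem_of_transcendental htr
      apply hq
      by_cases hqp : q = p
      · subst hqp
        exact (q.valuation_le_one_iff f).1 hlt.le
      · exact mem_sIntegers_iff.1 hf q hqp
    have hav : 1 < p.valuation (1 + e) := by
      rwa [Valuation.map_add_eq_of_lt_right]
      rwa [map_one]
    obtain ⟨n, hn1, hn2⟩ := p.valuation.pell_eq_chebyshev hp2 (sIntegers {p}) hA
      (add_mem (one_mem _) hep) hav hmem.1 hmem.2 h'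
    have hTn : (((T (sIntegers S) n).eval (1 + ⟨e, hsub hep⟩) : sIntegers S) : K) =
        (T K n).eval (1 + e) :=
      algebraMap_eval_T (R := sIntegers S) (R' := K)
        (1 + (⟨e, hsub hep⟩ : sIntegers S)) n
    have hUn : (((U (sIntegers S) (n - 1)).eval (1 + ⟨e, hsub hep⟩) : sIntegers S) : K) =
        (U K (n - 1)).eval (1 + e) :=
      algebraMap_eval_U (R := sIntegers S) (R' := K)
        (1 + (⟨e, hsub hep⟩ : sIntegers S)) (n - 1)
    refine ⟨n, Subtype.ext (hn1.trans hUn.symm), hn2.imp (fun h => Subtype.ext (h.trans hTn.symm))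
      fun h => Subtype.ext (h.trans (congrArg Neg.neg hTn.symm))⟩
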